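/- Let $d\ge 0$, let $\varphi$ be an automorphism of $\mathbb Z^d$, and let $G=\mathbb Z\ltimes_\varphi\mathbb Z^d$ be the semidirect product in which $1\in\mathbb Z$ acts on $\mathbb Z^d$ by $\varphi$; that is, $G=\mathbb Z\times\mathbb Z^d$ as a set, with $(i,x)\cdot(j,y)=(i+j,\,x+\varphi^i(y))$. Let $P_\varphi(t)\in\mathbb Z[t]$ be the characteristic polynomial of $\varphi$. For a prime $p$, a group $H$ is called residually $p$ if for every $h\in H$ with $h\neq 1$ there is a homomorphism $\alpha\colon H\to Q$ to a finite group $Q$ of order a power of $p$ with $\alpha(h)\ne 1$. A group is virtually nilpotent if it has a nilpotent subgroup of finite index. The automorphism $\varphi$ is unipotent if $(\varphi-\mathrm{id})^d=0$, and quasi-unipotent if $\varphi^k$ is unipotent for some integer $k>0$. Then the following hold. (1) For every prime $p$, the group $G$ is residually $p$ if and only if $P(1)\equiv 0 \bmod p$ for every irreducible factor $P(t)\in\mathbb Z[t]$ of $P_\varphi(t)$. (2) $G$ is residually $p$ for all primes $p$ if and only if $G$ is nilpotent, if and only if $\varphi$ is unipotent. (3) $G$ has a finite index subgroup which is residually $p$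 for all primes $p$ (one subgroup for all $p$) if and only if $G$ is virtually nilpotent, if and only if $\varphi$ is quasi-unipotent. -/

import Mathlib

open Polynomial

/-- A group `G` is residually `p` if every non-trivial element of `G` has non-trivial image under
some morphism from `G` to a finite group of order a power of `p`. -/
def IsResiduallyP (p : ℕ) (G : Type*) [Group G] : Prop :=
  ∀ g : G, g ≠ 1 →
    ∃ (P : Type) (_ : Group P) (α : G →* P), Finite P ∧ IsPGroup p P ∧ α g ≠ 1

/-- The group `G` has a (single) finite index subgroup which is residually `p` for all
primes `p`. -/
def IsVirtuallyResiduallyAllPrimes (G : Type*) [Group G] : Prop :=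
  ∃ H : Subgroup G, H.FiniteIndex ∧ ∀ p : ℕ, p.Prime → IsResiduallyP p H

/-- The action of `ℤ` on `ℤ^d` (both written multiplicatively) in which `i` acts by `φ ^ i`. -/
def mappingTorusAction {d : ℕ} (φ : (Fin d → ℤ) ≃ₗ[ℤ] (Fin d → ℤ)) :
    Multiplicative ℤ →* MulAut (Multiplicative (Fin d → ℤ)) :=
  zpowersHom _ (AddEquiv.toMultiplicative φ.toAddEquiv)

/-- The semidirect product `ℤ ⋉_φ ℤ^d`, where `1 ∈ ℤ` acts on `ℤ^d` by `φ`. -/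
abbrev MappingTorus {d : ℕ} (φ : (Fin d → ℤ) ≃ₗ[ℤ] (Fin d → ℤ)) : Type :=
  Multiplicative (Fin d → ℤ) ⋊[mappingTorusAction φ] Multiplicative ℤ

/-- An automorphism `φ` of `ℤ^d` is unipotent if `(φ - id)^d = 0`. -/
def IsUnipotentAut {d : ℕ} (φ : (Fin d → ℤ) ≃ₗ[ℤ] (Fin d → ℤ)) : Prop :=
  ((φ : Module.End ℤ (Fin d → ℤ)) - 1) ^ d = 0

/-- An automorphism `φ` of `ℤ^d` is quasi-unipotent if `φ ^ k` is unipotent for some `k > 0`. -/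
def IsQuasiUnipotentAut {d : ℕ} (φ : (Fin d → ℤ) ≃ₗ[ℤ] (Fin d → ℤ)) : Prop :=
  ∃ k : ℕ, 0 < k ∧ IsUnipotentAut (φ ^ k)

/-!
Make `ℤ^d` a module over `ℤ[X]` by letting `X` act as `φ`. The whole theorem rests on one
criterion, `AnnihilatorsVanishAtOne p φ`: every polynomial `P` for which `P(φ)` kills a non-zero
vector satisfies `p ∣ P(1)`.

* `isResiduallyP_mappingTorus_iff`: the group `G = ℤ ⋉_φ ℤ^d` is residually `p` if and only if the
  criterion holds. If `α : G → Q` is a morphism to a finite `p`-group, then the annihilator of the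
  image of a vector `x` in `ℤ^d / (ℤ^d ∩ ker α)` contains a power of `p`, and also a power of
  `X - 1` because `Q` is nilpotent. So it becomes the unit ideal as soon as it contains some `P`
  with `P(1)` prime to `p`. Conversely, put `I = (p, X - 1)`. By Krull's intersection theorem a
  vector in all `I^k ℤ^d` is killed by some `1 - r` with `r ∈ I`, which the criterion excludes
  unless the vector is zero. On the finite `p`-group `ℤ^d / I^k ℤ^d` the order of `φ` is a power of
  `p`, because `X^(p^m) - 1 ∈ I^(m+1)`, so that the corresponding semidirect product is a finite
  `p`-quotient of `G`.
* `annihilatorsVanishAtOne_iff`: the criterion only has to be tested on the irreducible factors of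
  the characteristic polynomial. Each of them kills a vector, as its roots are eigenvalues of `φ`;
  and each polynomial that kills a non-zero vector is a multiple of one of them, by a look at an
  associated prime of the module, which contains no non-zero integer.
* `forall_isResiduallyP_mappingTorus_iff`: the criterion holds for all `p` if and only if it holds
  with `P(1) = 0`, if and only if `φ` is unipotent.
* `isNilpotent_mappingTorus_iff`: commutators of translations with the generator of `ℤ` are given
  by `φ - 1`, so the lower central series of `G` is governed by the powers of `φ - 1`.

The statements about finite index subgroups follow from those about `G` itself, applied to the
groups `ℤ ⋉_{φ^k} ℤ^d`: such a group sits in `G` with finite index, and every finite index subgroup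
of `G` contains a copy of one of them (`MappingTorus.exists_injective_of_finiteIndex`).
-/

open scoped commutatorElement

/-! ### Residually `p` groups -/

theorem IsResiduallyP.of_injective {p : ℕ} {G H : Type*} [Group G] [Group H]
    (hH : IsResiduallyP p H) (f : G →* H) (hf : Function.Injective f) : IsResiduallyP p G := by
  intro g hg
  obtain ⟨P, _, α, hfin, hP, hα⟩ := hH (f g) ((map_ne_one_iff f hf).2 hg)
  exact ⟨P, _, α.comp f, hfin, hP, hα⟩

theorem Group.IsNilpotent.of_injective {G H : Type*} [Group G] [Group H]
    (hH : Group.IsNilpotent H) (f : G →* H) (hf : Function.Injective f) : Group.IsNilpotent G :=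
  (Group.isNilpotent_congr (MonoidHom.ofInjective hf)).2 inferInstance

/-! ### The group law of the mapping torus -/

section MappingTorus

variable {d : ℕ} (φ : (Fin d → ℤ) ≃ₗ[ℤ] (Fin d → ℤ))

theorem mappingTorusAction_apply (n : Multiplicative ℤ) (v : Multiplicative (Fin d → ℤ)) :
    mappingTorusAction φ n v = Multiplicative.ofAdd ((φ ^ n.toAdd) v.toAdd) := by
  let F : ((Fin d → ℤ) ≃ₗ[ℤ] (Fin d → ℤ)) →* MulAut (Multiplicative (Fin d → ℤ)) :=
    { toFun := fun ψ ↦ AddEquiv.toMultiplicative ψ.toAddEquiv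
      map_one' := rfl
      map_mul' := fun _ _ ↦ rfl }
  have h : mappingTorusAction φ n = F (φ ^ n.toAdd) := (map_zpow F φ n.toAdd).symm
  rw [h]
  rfl

namespace MappingTorus

/-- The translation by `v`, that is, the element `(0, v)` of `ℤ ⋉_φ ℤ^d`. -/
def trans (v : Fin d → ℤ) : MappingTorus φ := SemidirectProduct.inl (Multiplicative.ofAdd v)

theorem trans_add (v w : Fin d → ℤ) : trans φ (v + w) = trans φ v * trans φ w := by
  simp [trans]

theorem trans_zero : trans φ 0 = 1 := by simp [trans]

theorem trans_neg (v : Fin d → ℤ) : trans φ (-v) = (trans φ v)⁻¹ := by simp [trans]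

theorem trans_smul (n : ℤ) (v : Fin d → ℤ) : trans φ (n • v) = trans φ v ^ n := by
  rw [trans, ofAdd_zsmul, map_zpow, trans]

theorem trans_injective : Function.Injective (trans φ) :=
  SemidirectProduct.inl_injective.comp Multiplicative.ofAdd.injective

theorem conj_trans (g : MappingTorus φ) (v : Fin d → ℤ) :
    g * trans φ v * g⁻¹ = trans φ ((φ ^ g.right.toAdd) v) := by
  refine SemidirectProduct.ext ?_ (by simp [trans])
  have h (u : Multiplicative (Fin d → ℤ)) :
      mappingTorusAction φ g.right (mappingTorusAction φ g.right⁻¹ u) = u := by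
    rw [← MulAut.mul_apply, ← map_mul, mul_inv_cancel, map_one, MulAut.one_apply]
  simp only [trans, SemidirectProduct.mul_left, SemidirectProduct.inv_left,
    SemidirectProduct.mul_right, SemidirectProduct.left_inl, SemidirectProduct.right_inl, mul_one,
    h, mul_comm g.left, mul_inv_cancel_right]
  rw [mappingTorusAction_apply, toAdd_ofAdd]

theorem commutator_trans (v : Fin d → ℤ) (g : MappingTorus φ) :
    ⁅trans φ v, g⁆ = trans φ (v - (φ ^ g.right.toAdd) v) := by
  have h := conj_trans φ g (-v)
  rw [map_neg, trans_neg] at h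
  rw [commutatorElement_def, mul_assoc, mul_assoc, ← mul_assoc g, h, sub_eq_add_neg, trans_add]

/-- Up to sign, an iterated commutator of a translation by `v` with the generator of `ℤ` is the
translation by `(φ - 1)^c v`. -/
theorem map_trans_sub_one_pow_mem_lowerCentralSeries {Q : Type*} [Group Q] (α : MappingTorus φ →* Q)
    (v : Fin d → ℤ) (c : ℕ) :
    α (trans φ ((((φ : Module.End ℤ (Fin d → ℤ)) - 1) ^ c) v)) ∈
      (⊤ : Subgroup Q).lowerCentralSeries c := by
  induction c with
  | zero => simp
  | succ c ih =>
    have h := Subgroup.commutator_mem_commutator ih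
      (Subgroup.mem_top (α (SemidirectProduct.inr (Multiplicative.ofAdd 1))))
    rw [← map_commutatorElement, commutator_trans] at h
    rw [Subgroup.lowerCentralSeries_succ, ← inv_mem_iff, ← map_inv, ← trans_neg]
    convert h using 3
    rw [pow_succ']
    simp

/-- The homomorphism `(n, v) ↦ (k n, m v)` from `ℤ ⋉_{φ^k} ℤ^d` to `ℤ ⋉_φ ℤ^d`. -/
def scale (m k : ℕ) : MappingTorus (φ ^ k) →* MappingTorus φ :=
  SemidirectProduct.map (powMonoidHom m) (powMonoidHom k) (by
    intro g
    refine MonoidHom.ext fun v ↦ ?_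
    change (mappingTorusAction (φ ^ k) g v) ^ m = mappingTorusAction φ (g ^ k) (v ^ m)
    rw [← map_pow, mappingTorusAction_apply, mappingTorusAction_apply, toAdd_pow g, nsmul_eq_mul,
      zpow_mul, zpow_natCast])

theorem scale_eq (m k : ℕ) (x : MappingTorus (φ ^ k)) :
    scale φ m k x = ⟨x.left ^ m, x.right ^ k⟩ := rfl

theorem scale_injective {m k : ℕ} (hm : m ≠ 0) (hk : k ≠ 0) :
    Function.Injective (scale φ m k) := by
  intro x y h
  exact SemidirectProduct.ext (pow_left_injective hm (congrArg SemidirectProduct.left h))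
    (pow_left_injective hk (congrArg SemidirectProduct.right h))

theorem scale_mem {H : Subgroup (MappingTorus φ)} {m k : ℕ} (hm : ∀ g : MappingTorus φ, g ^ m ∈ H)
    (hk : ∀ g : MappingTorus φ, g ^ k ∈ H) (x : MappingTorus (φ ^ k)) : scale φ m k x ∈ H := by
  have h : scale φ m k x =
      (SemidirectProduct.inl x.left) ^ m * (SemidirectProduct.inr x.right) ^ k := by
    rw [scale_eq, SemidirectProduct.mk_eq_inl_mul_inr, map_pow, map_pow]
  rw [h]
  exact mul_mem (hm _) (hk _)

/-- The image of `scale φ 1 k` in `ℤ ⋉_φ ℤ^d` is the preimage of `kℤ`. -/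
theorem finiteIndex_range_scale {k : ℕ} (hk : k ≠ 0) : (scale φ 1 k).range.FiniteIndex := by
  have : NeZero k := ⟨hk⟩
  let π : MappingTorus φ →* Multiplicative (ZMod k) :=
    (AddMonoidHom.toMultiplicative (Int.castAddHom (ZMod k))).comp SemidirectProduct.rightHom
  refine Subgroup.finiteIndex_of_le (H := π.ker) fun x hx ↦ ?_
  have hx' : ((x.right.toAdd : ℤ) : ZMod k) = 0 := hx
  obtain ⟨n, hn⟩ := (ZMod.intCast_zmod_eq_zero_iff_dvd _ _).1 hx'
  refine ⟨⟨x.left, Multiplicative.ofAdd n⟩, ?_⟩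
  rw [scale_eq]
  refine SemidirectProduct.ext (pow_one _) ?_
  rw [← ofAdd_nsmul, nsmul_eq_mul, ← hn, ofAdd_toAdd]

end MappingTorus

end MappingTorus

/-- A finite index subgroup of `ℤ ⋉_φ ℤ^d` contains a copy of some `ℤ ⋉_{φ^k} ℤ^d`, `k > 0`. -/
theorem MappingTorus.exists_injective_of_finiteIndex {d : ℕ} (φ : (Fin d → ℤ) ≃ₗ[ℤ] (Fin d → ℤ))
    (H : Subgroup (MappingTorus φ)) [hH : H.FiniteIndex] :
    ∃ k : ℕ, 0 < k ∧ ∃ f : MappingTorus (φ ^ k) →* H, Function.Injective f := by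
  have hk (g : MappingTorus φ) : g ^ H.index.factorial ∈ H :=
    H.pow_mem_of_index_ne_zero_of_dvd hH.index_ne_zero g fun m hm hle ↦ Nat.dvd_factorial hm hle
  have h0 := Nat.factorial_pos H.index
  refine ⟨H.index.factorial, h0, (scale φ _ _).codRestrict H (scale_mem φ hk hk), ?_⟩
  exact fun x y hxy ↦ scale_injective φ h0.ne' h0.ne' (congrArg Subtype.val hxy)

/-! ### Annihilators in `ℤ[X]` of vectors of `ℤ^d` -/

theorem Matrix.aeval_toLin' {R n : Type*} [CommRing R] [Fintype n] [DecidableEq n]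
    (A : Matrix n n R) (P : R[X]) : aeval (Matrix.toLin' A) P = Matrix.toLin' (aeval A P) :=
  aeval_algHom_apply (Matrix.toLinAlgEquiv' : Matrix n n R ≃ₐ[R] _) A P

section Annihilator

variable {d : ℕ}

/-- Every polynomial `P` such that `P(φ)` kills a non-zero vector satisfies `P(1) ≡ 0 mod p`. The
annihilators meant are those of the vectors of `ℤ^d`, viewed as a `ℤ[X]`-module via `φ`. -/
def AnnihilatorsVanishAtOne (p : ℕ) (φ : Module.End ℤ (Fin d → ℤ)) : Prop :=
  ∀ x : Fin d → ℤ, x ≠ 0 → ∀ P : ℤ[X], aeval φ P x = 0 → (p : ℤ) ∣ P.eval 1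

/-- An irreducible factor of the characteristic polynomial has a complex root `μ`, which is an
eigenvalue of `φ`, so that `P(φ)` has determinant `0`. -/
theorem exists_aeval_apply_eq_zero_of_dvd_charpoly (φ : Module.End ℤ (Fin d → ℤ)) {P : ℤ[X]}
    (hP : Irreducible P) (hdvd : P ∣ φ.charpoly) : ∃ x ≠ 0, aeval φ P x = 0 := by
  -- a constant dividing a monic polynomial is a unit
  have hdeg : P.degree ≠ 0 := by
    intro h
    rw [eq_C_of_degree_eq_zero h] at hP hdvd
    refine hP.not_isUnit (isUnit_C.2 ?_)
    have := (C_dvd_iff_dvd_coeff _ _).1 hdvd φ.charpoly.natDegree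
    rw [coeff_natDegree, φ.charpoly_monic.leadingCoeff] at this
    exact isUnit_of_dvd_one this
  set A : Matrix (Fin d) (Fin d) ℤ := LinearMap.toMatrix' φ with hA
  let f : ℤ →+* ℂ := Int.castRingHom ℂ
  have hf : Function.Injective f := Int.cast_injective
  obtain ⟨μ, hμ⟩ := IsAlgClosed.exists_aeval_eq_zero ℂ P hdeg
  have hchar : (A.map f).charpoly.eval μ = 0 := by
    have h1 : A.charpoly = φ.charpoly := LinearMap.charpoly_toMatrix φ (Pi.basisFun ℤ (Fin d))
    rw [Matrix.charpoly_map, h1, eval_map]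
    change aeval μ φ.charpoly = 0
    exact zero_dvd_iff.1 (hμ ▸ map_dvd (aeval μ) hdvd)
  rw [Matrix.eval_charpoly, ← Matrix.exists_mulVec_eq_zero_iff] at hchar
  obtain ⟨v, hv0, hv⟩ := hchar
  have hv' : (Matrix.toLin' (A.map f)) v = μ • v := by
    rw [Matrix.sub_mulVec, sub_eq_zero] at hv
    rw [Matrix.toLin'_apply, ← hv]
    simp
  have hdet : (aeval A P).det = 0 := by
    apply hf
    rw [map_zero, RingHom.map_det, ← Matrix.exists_mulVec_eq_zero_iff]
    refine ⟨v, hv0, ?_⟩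
    have h2 := Module.End.aeval_apply_of_hasEigenvector (p := P.map f)
      (Module.End.hasEigenvector_iff.2 ⟨Module.End.mem_eigenspace_iff.2 hv', hv0⟩)
    have h3 : (P.map f).eval μ = 0 := by rwa [eval_map]
    rw [h3, zero_smul] at h2
    rw [Matrix.aeval_toLin', Matrix.toLin'_apply] at h2
    rw [← h2]
    congr 1
    exact Polynomial.map_aeval_eq_aeval_map (S := Matrix (Fin d) (Fin d) ℤ)
      (U := Matrix (Fin d) (Fin d) ℂ) (φ := f) (ψ := f.mapMatrix) (by ext; simp) P A
  obtain ⟨x, hx0, hx⟩ := Matrix.exists_mulVec_eq_zero_iff.2 hdet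
  refine ⟨x, hx0, ?_⟩
  have h4 : aeval φ P = Matrix.toLin' (aeval A P) := by
    rw [← Matrix.aeval_toLin', hA, Matrix.toLin'_toMatrix']
  rw [h4, Matrix.toLin'_apply, hx]

/-- The polynomials killing a suitable multiple of `x` form a prime ideal containing all
polynomials that kill `x` and no non-zero integer. -/
theorem exists_irreducible_dvd_of_aeval_apply_eq_zero (φ : Module.End ℤ (Fin d → ℤ))
    {x : Fin d → ℤ} (hx : x ≠ 0) {f : ℤ[X]} (hf : aeval φ f x = 0) :
    ∃ P, Irreducible P ∧ P ∣ φ.charpoly ∧ P ∣ f := by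
  obtain ⟨I, hI, hxI⟩ := exists_le_isAssociatedPrime_of_isNoetherianRing ℤ[X]
    (Module.AEval'.of φ x) (by simpa using hx)
  obtain ⟨hIprime, y, rfl⟩ := isAssociatedPrime_iff.1 hI
  have hann {g : ℤ[X]} (hg : aeval φ g x = 0) :
      g ∈ (⊥ : Submodule ℤ[X] (Module.AEval' φ)).colon {y} := by
    refine hxI ?_
    rw [Submodule.mem_colon_singleton, Submodule.mem_bot, ← Module.AEval.of_aeval_smul]
    simpa using hg
  have hfI := hann hf
  have hcI : φ.charpoly ∈ (⊥ : Submodule ℤ[X] (Module.AEval' φ)).colon {y} :=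
    hann (by rw [LinearMap.aeval_self_charpoly, LinearMap.zero_apply])
  have hy : y ≠ 0 := by
    rintro rfl
    exact hIprime.ne_top (by simp)
  -- `ℤ^d` is torsion-free, so no non-zero integer kills `y`
  have hint {n : ℤ} (hn : C n ∈ (⊥ : Submodule ℤ[X] (Module.AEval' φ)).colon {y}) : n = 0 := by
    rw [Submodule.mem_colon_singleton, Submodule.mem_bot, Module.AEval.C_smul] at hn
    by_contra h
    apply hy
    apply (Module.AEval'.of φ).symm.injective
    have := congrArg (Module.AEval'.of φ).symm hn
    rw [map_smul, map_zero] at this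
    rw [map_zero]
    exact (smul_eq_zero.1 this).resolve_left h
  generalize (⊥ : Submodule ℤ[X] (Module.AEval' φ)).colon {y} = J at *
  obtain ⟨P, hPJ, hP⟩ : ∃ P ∈ UniqueFactorizationMonoid.factors φ.charpoly, P ∈ J := by
    rw [← hIprime.multiset_prod_mem_iff_exists_mem]
    obtain ⟨u, hu⟩ := UniqueFactorizationMonoid.factors_prod φ.charpoly_monic.ne_zero
    rw [← hu] at hcI
    exact (hIprime.mem_or_mem hcI).resolve_right
      fun h ↦ hIprime.ne_top (J.eq_top_of_isUnit_mem h u.isUnit)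
  have hPirr := UniqueFactorizationMonoid.irreducible_of_factor P hPJ
  have hPdvd := UniqueFactorizationMonoid.dvd_of_mem_factors hPJ
  refine ⟨P, hPirr, hPdvd, ?_⟩
  by_contra hndvd
  -- `ℤ[X]/(P)` is a domain, integral over `ℤ`: the ideal generated by `f` meets `ℤ`
  have : (Ideal.span {P}).IsPrime := (Ideal.span_singleton_prime hPirr.ne_zero).2 hPirr.prime
  let B := ℤ[X] ⧸ Ideal.span {P}
  have hint' (b : B) : IsIntegral ℤ b :=
    φ.charpoly_monic.quotient_isIntegral (Ideal.mem_span_singleton.2 hPdvd) b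
  have hf0 : Ideal.Quotient.mk (Ideal.span {P}) f ≠ 0 := by
    rwa [Ne, Ideal.Quotient.eq_zero_iff_mem, Ideal.mem_span_singleton]
  have hne := Ideal.comap_ne_bot_of_integral_mem (R := ℤ) hf0
    (Ideal.mem_span_singleton_self _) (hint' _)
  obtain ⟨n, hn, hn0⟩ := Submodule.exists_mem_ne_zero_of_ne_bot hne
  refine hn0 (hint ?_)
  rw [Ideal.mem_comap, Ideal.mem_span_singleton] at hn
  obtain ⟨b, hb⟩ := hn
  obtain ⟨b, rfl⟩ := Ideal.Quotient.mk_surjective b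
  have h5 : Ideal.Quotient.mk (Ideal.span {P}) (C n - f * b) = 0 := by
    rw [map_sub, map_mul, ← hb, sub_eq_zero]
    rfl
  rw [Ideal.Quotient.eq_zero_iff_mem] at h5
  have h6 : Ideal.span {P} ≤ J := (Ideal.span_singleton_le_iff_mem J).2 hP
  have := J.add_mem (h6 h5) (J.mul_mem_right b hfI)
  rwa [sub_add_cancel] at this

theorem annihilatorsVanishAtOne_iff (p : ℕ) (φ : Module.End ℤ (Fin d → ℤ)) :
    AnnihilatorsVanishAtOne p φ ↔
      ∀ P : ℤ[X], Irreducible P → P ∣ φ.charpoly → P.eval 1 ≡ 0 [ZMOD (p : ℤ)] := by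
  simp only [Int.modEq_zero_iff_dvd]
  constructor
  · intro h P hP hdvd
    obtain ⟨x, hx0, hx⟩ := exists_aeval_apply_eq_zero_of_dvd_charpoly φ hP hdvd
    exact h x hx0 P hx
  · intro h x hx0 f hf
    obtain ⟨P, hP, hdvd, hPf⟩ := exists_irreducible_dvd_of_aeval_apply_eq_zero φ hx0 hf
    exact (h P hP hdvd).trans (eval_dvd hPf)

end Annihilator

/-! ### Residually `p` mapping tori -/

/-- The ideal `(p, X - 1)` of `ℤ[X]`, consisting of the `f` with `p ∣ f(1)`. -/
noncomputable def augmentationIdeal (p : ℕ) : Ideal ℤ[X] := Ideal.span {C (p : ℤ), X - 1}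

theorem natCast_mem_augmentationIdeal (p : ℕ) : (p : ℤ[X]) ∈ augmentationIdeal p :=
  Ideal.subset_span (by simp)

theorem X_sub_one_mem_augmentationIdeal (p : ℕ) : (X - 1 : ℤ[X]) ∈ augmentationIdeal p :=
  Ideal.subset_span (by simp)

theorem dvd_eval_one_of_mem_augmentationIdeal {p : ℕ} {f : ℤ[X]} (hf : f ∈ augmentationIdeal p) :
    (p : ℤ) ∣ f.eval 1 := by
  obtain ⟨a, b, rfl⟩ := Ideal.mem_span_pair.1 hf
  simp

theorem X_pow_prime_pow_sub_one_mem (p m : ℕ) :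
    (X ^ p ^ m - 1 : ℤ[X]) ∈ augmentationIdeal p ^ (m + 1) := by
  induction m with
  | zero => simpa using X_sub_one_mem_augmentationIdeal p
  | succ m ih =>
    -- `Y^p - 1 = (1 + Y + ⋯ + Y^(p-1)) (Y - 1)`, whose first factor is `p` modulo `Y - 1`
    set Y : ℤ[X] := X ^ p ^ m with hY
    have hYI : Y - 1 ∈ augmentationIdeal p := Ideal.pow_le_self (by simp) ih
    rw [pow_succ p, pow_mul, ← hY, ← geom_sum_mul, pow_succ' _ (m + 1)]
    refine Ideal.mul_mem_mul ?_ ih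
    rw [← Ideal.Quotient.eq_zero_iff_mem] at hYI ⊢
    have h1 := natCast_mem_augmentationIdeal p
    rw [← Ideal.Quotient.eq_zero_iff_mem, map_natCast] at h1
    rw [map_sub, map_one, sub_eq_zero] at hYI
    simp [hYI, h1]

section

variable {d : ℕ} (φ : (Fin d → ℤ) ≃ₗ[ℤ] (Fin d → ℤ))

theorem LinearEquiv.coe_toLinearMap_pow_apply {R M : Type*} [Semiring R] [AddCommMonoid M]
    [Module R M] (φ : M ≃ₗ[R] M) (n : ℕ) (v : M) : ((φ : Module.End R M) ^ n) v = (φ ^ n) v :=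
  DFunLike.congr_fun (map_pow (LinearEquiv.automorphismGroup.toLinearMapMonoidHom) φ n).symm v

theorem aeval_natCast_pow_apply (ψ : Module.End ℤ (Fin d → ℤ)) (p e : ℕ) (v : Fin d → ℤ) :
    aeval ψ ((p : ℤ[X]) ^ e) v = ((p ^ e : ℕ) : ℤ) • v := by
  rw [← Nat.cast_pow, map_natCast, Module.End.natCast_apply, natCast_zsmul]

/-- The polynomials `f` with `f(φ) x` in the kernel of a morphism to a finite `p`-group form an
ideal containing some `p^e` and some `(X - 1)^c`; if it contained a polynomial `P` with
`P(1)` prime to `p`, it would be the whole ring. -/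
theorem IsResiduallyP.annihilatorsVanishAtOne {p : ℕ} (hp : p.Prime)
    (h : IsResiduallyP p (MappingTorus φ)) :
    AnnihilatorsVanishAtOne p (φ : Module.End ℤ (Fin d → ℤ)) := by
  intro x hx P hPx
  obtain ⟨Q, _, α, _, hQ, hα⟩ := h (MappingTorus.trans φ x)
    (by rwa [← MappingTorus.trans_zero φ, (MappingTorus.trans_injective φ).ne_iff])
  have : Fact p.Prime := ⟨hp⟩
  by_contra hdvd
  refine hα ?_
  let J : Submodule ℤ (Fin d → ℤ) :=
    { carrier := {v | α (MappingTorus.trans φ v) = 1}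
      add_mem' := fun {v w} hv hw ↦ by
        simp only [Set.mem_ofPred_eq] at *
        rw [MappingTorus.trans_add, map_mul, hv, hw, one_mul]
      zero_mem' := by simp [MappingTorus.trans_zero]
      smul_mem' := fun n v hv ↦ by
        simp only [Set.mem_ofPred_eq] at *
        rw [MappingTorus.trans_smul, map_zpow, hv, one_zpow] }
  have hJφ (v) (hv : v ∈ J) : φ v ∈ J := by
    have := MappingTorus.conj_trans φ (SemidirectProduct.inr (Multiplicative.ofAdd 1)) v
    rw [SemidirectProduct.right_inr, toAdd_ofAdd, zpow_one] at this
    change α (MappingTorus.trans φ (φ v)) = 1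
    rw [← this, map_mul, map_mul, show α (MappingTorus.trans φ v) = 1 from hv, mul_one, map_inv,
      mul_inv_cancel]
  let J' : Submodule ℤ[X] (Module.AEval' (φ : Module.End ℤ (Fin d → ℤ))) :=
    Module.AEval.mapSubmodule ℤ _ _ ⟨J, hJφ⟩
  let I : Ideal ℤ[X] := J'.comap (LinearMap.toSpanSingleton ℤ[X] _ (Module.AEval'.of _ x))
  have hI (f : ℤ[X]) : f ∈ I ↔
      α (MappingTorus.trans φ (aeval (φ : Module.End ℤ (Fin d → ℤ)) f x)) = 1 :=
    Module.AEval.mem_mapSubmodule_apply ℤ _ _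
  have hPI : P ∈ I := by rw [hI, hPx, MappingTorus.trans_zero, map_one]
  suffices htop : I = ⊤ by
    simpa using (hI 1).1 (htop ▸ Submodule.mem_top)
  by_contra htop
  obtain ⟨𝔪, hm, hle⟩ := I.exists_le_maximal htop
  have hmp := hm.isPrime
  have h1 : (p : ℤ[X]) ∈ 𝔪 := by
    obtain ⟨e, he⟩ := hQ (α (MappingTorus.trans φ x))
    refine hmp.mem_of_pow_mem e (hle ((hI _).2 ?_))
    rw [aeval_natCast_pow_apply, MappingTorus.trans_smul, map_zpow, zpow_natCast, he]
  have h2 : (X - 1 : ℤ[X]) ∈ 𝔪 := by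
    obtain ⟨c, hc⟩ := Subgroup.nilpotent_iff_lowerCentralSeries.1 hQ.isNilpotent
    refine hmp.mem_of_pow_mem c (hle ((hI _).2 ?_))
    have := MappingTorus.map_trans_sub_one_pow_mem_lowerCentralSeries φ α x c
    rw [hc, Subgroup.mem_bot] at this
    simpa using this
  have h3 : C (P.eval 1) ∈ 𝔪 := by
    have h4 : X - C 1 ∣ P - C (P.eval 1) := X_sub_C_dvd_sub_C_eval
    have h5 := 𝔪.sub_mem (hle hPI) (𝔪.mem_of_dvd h4 (by simpa using h2))
    rwa [sub_sub_cancel] at h5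
  obtain ⟨a, b, hab⟩ := (Nat.prime_iff_prime_int.1 hp).irreducible.coprime_iff_not_dvd.2 hdvd
  apply hm.ne_top
  rw [Ideal.eq_top_iff_one, ← C_1, ← hab, C_add, C_mul, C_mul]
  exact 𝔪.add_mem (𝔪.mul_mem_left _ (by simpa using h1)) (𝔪.mul_mem_left _ h3)

theorem MulAut.map_zpow_apply {A B : Type*} [Group A] [Group B] (f : A →* B) (a : MulAut A)
    (b : MulAut B) (h : ∀ x, f (a x) = b (f x)) (n : ℤ) (x : A) :
    f ((a ^ n) x) = (b ^ n) (f x) := by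
  have hnat (n : ℕ) (x : A) : f ((a ^ n) x) = (b ^ n) (f x) := by
    induction n generalizing x with
    | zero => rfl
    | succ n ih => rw [pow_succ, pow_succ, MulAut.mul_apply, MulAut.mul_apply, ih, h]
  obtain ⟨n, rfl | rfl⟩ := n.eq_nat_or_neg
  · simpa using hnat n x
  · apply (b ^ n).injective
    rw [← hnat, zpow_neg, zpow_neg, zpow_natCast, zpow_natCast, MulAut.apply_inv_self,
      MulAut.apply_inv_self]

/-- If `W` is a `φ`-stable subgroup of `p`-power index on whose quotient `φ` has `p`-power order,
then `ℤ ⋉_φ ℤ^d` maps to the semidirect product of the finite `p`-groups `⟨φ⟩` and `ℤ^d / W`. -/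
theorem exists_pgroup_map_ne_one {p : ℕ} [Fact p.Prime] (W : Submodule ℤ (Fin d → ℤ))
    (hW : ∀ v ∈ W, φ v ∈ W) [Finite ((Fin d → ℤ) ⧸ W)]
    (hp : IsPGroup p (Multiplicative ((Fin d → ℤ) ⧸ W))) (m : ℕ)
    (hm : ∀ v, (φ ^ p ^ m) v - v ∈ W) (v : Fin d → ℤ) (hv : v ∉ W) (n : Multiplicative ℤ) :
    ∃ (P : Type) (_ : Group P) (α : MappingTorus φ →* P), Finite P ∧ IsPGroup p P ∧
      α ⟨Multiplicative.ofAdd v, n⟩ ≠ 1 := by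
  let q := W.mapQ W (φ : Module.End ℤ (Fin d → ℤ)) hW
  have hqs : Function.Surjective q := by
    intro y
    obtain ⟨y, rfl⟩ := W.mkQ_surjective y
    exact ⟨W.mkQ (φ.symm y), by simp [q]⟩
  let e : MulAut (Multiplicative ((Fin d → ℤ) ⧸ W)) := AddEquiv.toMultiplicative
    (LinearEquiv.ofBijective q ⟨Finite.injective_iff_surjective.2 hqs, hqs⟩).toAddEquiv
  let f : Multiplicative (Fin d → ℤ) →* Multiplicative ((Fin d → ℤ) ⧸ W) :=
    AddMonoidHom.toMultiplicative W.mkQ.toAddMonoidHom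
  have hfs : Function.Surjective f := W.mkQ_surjective
  have hfe (n : Multiplicative ℤ) (v) : f (mappingTorusAction φ n v) = (e ^ n.toAdd) (f v) :=
    MulAut.map_zpow_apply f _ e (fun _ ↦ rfl) n.toAdd v
  have he : e ^ p ^ m = 1 := by
    ext y
    obtain ⟨y, rfl⟩ := hfs y
    have := hfe (Multiplicative.ofAdd ((p ^ m : ℕ) : ℤ)) y
    rw [toAdd_ofAdd, zpow_natCast] at this
    rw [← this, mappingTorusAction_apply, toAdd_ofAdd, zpow_natCast]
    exact (Submodule.Quotient.eq W).2 (hm y.toAdd)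
  have hfinite : Finite (Subgroup.zpowers e) := by
    refine Nat.finite_of_card_ne_zero ?_
    rw [Nat.card_zpowers]
    exact (orderOf_pos_iff.2 (isOfFinOrder_iff_pow_eq_one.2
      ⟨p ^ m, pow_pos (Nat.Prime.pos Fact.out) _, he⟩)).ne'
  obtain ⟨j, -, hj⟩ := (Nat.dvd_prime_pow Fact.out).1 (orderOf_dvd_of_pow_eq_one he)
  obtain ⟨i, hi⟩ := IsPGroup.iff_card.1 hp
  let P := Multiplicative ((Fin d → ℤ) ⧸ W) ⋊[(Subgroup.zpowers e).subtype] Subgroup.zpowers e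
  let α : MappingTorus φ →* P := SemidirectProduct.map f
    (zpowersHom _ ⟨e, Subgroup.mem_zpowers e⟩) (by
      intro n
      refine MonoidHom.ext fun v ↦ ?_
      exact hfe n v)
  refine ⟨P, inferInstance, α, Finite.of_equiv _ SemidirectProduct.equivProd.symm,
    IsPGroup.of_card (n := i + j) ?_, fun h ↦ hv ?_⟩
  · rw [SemidirectProduct.card, hi, Nat.card_zpowers, hj, pow_add]
  · exact (Submodule.Quotient.mk_eq_zero W).1 (congrArg SemidirectProduct.left h)

/-- By Krull's intersection theorem, `x` avoids `I^k ℤ^d` for some `k`, where `I = (p, X - 1)`: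
otherwise `x` is killed by some polynomial `1 - r` with `r ∈ I`. -/
theorem AnnihilatorsVanishAtOne.isResiduallyP {p : ℕ} (hp : p.Prime)
    (h : AnnihilatorsVanishAtOne p (φ : Module.End ℤ (Fin d → ℤ))) :
    IsResiduallyP p (MappingTorus φ) := by
  have : Fact p.Prime := ⟨hp⟩
  intro g hg
  -- a power of the generator of `ℤ` survives in a cyclic quotient of `ℤ`
  by_cases hv : g.left.toAdd = 0
  · have hn : g.right.toAdd ≠ 0 := fun hn ↦ hg (SemidirectProduct.ext hv hn)
    obtain ⟨j, hj⟩ : ∃ j : ℕ, ¬ ((p ^ j : ℕ) : ℤ) ∣ g.right.toAdd := by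
      refine ⟨g.right.toAdd.natAbs, fun hdvd ↦ ?_⟩
      rw [Int.natCast_dvd] at hdvd
      exact (Nat.lt_pow_self hp.one_lt).not_ge
        (Nat.le_of_dvd (Int.natAbs_pos.2 hn) hdvd)
    refine ⟨Multiplicative (ZMod (p ^ j)), inferInstance,
      (AddMonoidHom.toMultiplicative (Int.castAddHom (ZMod (p ^ j)))).comp
        SemidirectProduct.rightHom, ?_, IsPGroup.of_card (n := j) ?_, fun h1 ↦ hj ?_⟩
    · have : NeZero (p ^ j) := ⟨pow_ne_zero _ hp.ne_zero⟩
      exact inferInstanceAs (Finite (ZMod (p ^ j)))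
    · exact Nat.card_zmod _
    · exact (ZMod.intCast_zmod_eq_zero_iff_dvd _ _).1 h1
  · set x := g.left.toAdd with hx
    let M := Module.AEval' (φ : Module.End ℤ (Fin d → ℤ))
    let o : (Fin d → ℤ) ≃ₗ[ℤ] M := Module.AEval'.of (φ : Module.End ℤ (Fin d → ℤ))
    obtain ⟨k, hk⟩ : ∃ k, o x ∉ (augmentationIdeal p ^ (k + 1) • ⊤ : Submodule ℤ[X] M) := by
      by_contra! hall
      have hmem : o x ∈ (⨅ i, augmentationIdeal p ^ i • ⊤ : Submodule ℤ[X] M) := by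
        refine (Submodule.mem_iInf _).2 fun i ↦ ?_
        cases i with
        | zero => simp
        | succ i => exact hall i
      obtain ⟨⟨r, hr⟩, hrx⟩ := (Ideal.mem_iInf_smul_pow_eq_bot_iff _ _).1 hmem
      have h1 := h x hv (1 - r) (by
        have : aeval (φ : Module.End ℤ (Fin d → ℤ)) r x = x := congrArg o.symm hrx
        rw [map_sub, map_one, LinearMap.sub_apply, this, Module.End.one_apply, sub_self])
      have h2 := dvd_eval_one_of_mem_augmentationIdeal hr
      have h3 := (dvd_add_right h2).2 h1
      rw [eval_sub, eval_one, add_sub_cancel] at h3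
      exact (Nat.prime_iff_prime_int.1 hp).not_dvd_one h3
    obtain ⟨N, hxN, hN⟩ : ∃ N : Submodule ℤ[X] M, o x ∉ N ∧
        ∀ f ∈ augmentationIdeal p ^ (k + 1), ∀ y : M, f • y ∈ N :=
      ⟨_, hk, fun f hf y ↦ Submodule.smul_mem_smul hf Submodule.mem_top⟩
    let W : Submodule ℤ (Fin d → ℤ) := (N.restrictScalars ℤ).comap o.toLinearMap
    have hWmem {f : ℤ[X]} (hf : f ∈ augmentationIdeal p ^ (k + 1)) (v) :
        aeval (φ : Module.End ℤ (Fin d → ℤ)) f v ∈ W :=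
      hN f hf (o v)
    have hWp (v : Fin d → ℤ) : ((p ^ (k + 1) : ℕ) : ℤ) • v ∈ W := by
      have := hWmem (Ideal.pow_mem_pow (natCast_mem_augmentationIdeal p) (k + 1)) v
      rwa [aeval_natCast_pow_apply] at this
    have hWfin : Finite ((Fin d → ℤ) ⧸ W) := by
      refine Module.finite_of_fg_torsion _ fun y ↦ ?_
      obtain ⟨y, rfl⟩ := W.mkQ_surjective y
      have h0 : ((p ^ (k + 1) : ℕ) : ℤ) ≠ 0 := by exact_mod_cast pow_ne_zero _ hp.ne_zero
      refine ⟨⟨_, mem_nonZeroDivisors_of_ne_zero h0⟩, ?_⟩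
      exact (Submodule.Quotient.mk_eq_zero W).2 (hWp y)
    refine exists_pgroup_map_ne_one φ W ?_ ?_ k ?_ x hxN g.right
    · intro v hv
      have h1 : (X : ℤ[X]) • o v ∈ N := N.smul_mem X hv
      exact (Module.AEval'.X_smul_of (φ : Module.End ℤ (Fin d → ℤ)) v) ▸ h1
    · intro y
      refine ⟨k + 1, ?_⟩
      obtain ⟨z, hz⟩ := W.mkQ_surjective y.toAdd
      apply Multiplicative.toAdd.injective
      rw [toAdd_pow, ← hz, ← natCast_zsmul, ← map_smul, toAdd_one]
      exact (Submodule.Quotient.mk_eq_zero W).2 (hWp z)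
    · intro v
      have := hWmem (X_pow_prime_pow_sub_one_mem p k) v
      rw [map_sub, map_pow, aeval_X, map_one, LinearMap.sub_apply, Module.End.one_apply,
        LinearEquiv.coe_toLinearMap_pow_apply] at this
      exact this

theorem isResiduallyP_mappingTorus_iff {p : ℕ} (hp : p.Prime) :
    IsResiduallyP p (MappingTorus φ) ↔
      AnnihilatorsVanishAtOne p (φ : Module.End ℤ (Fin d → ℤ)) :=
  ⟨fun h ↦ h.annihilatorsVanishAtOne φ hp, fun h ↦ h.isResiduallyP φ hp⟩

end

/-! ### Unipotent automorphisms -/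

section

variable {d : ℕ} (φ : (Fin d → ℤ) ≃ₗ[ℤ] (Fin d → ℤ))

theorem isUnipotentAut_iff_isNilpotent :
    IsUnipotentAut φ ↔ IsNilpotent ((φ : Module.End ℤ (Fin d → ℤ)) - 1) := by
  refine ⟨fun h ↦ ⟨d, h⟩, fun ⟨n, hn⟩ ↦ ?_⟩
  have h := (LinearMap.charpoly_eq_X_pow_iff _).2 fun m ↦ ⟨n, by rw [hn, LinearMap.zero_apply]⟩
  have h' := LinearMap.aeval_self_charpoly ((φ : Module.End ℤ (Fin d → ℤ)) - 1)
  rw [h, map_pow, aeval_X, Module.finrank_fin_fun] at h'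
  exact h'

/-- A polynomial `P` with `P(φ) x = 0` also kills the last non-zero vector among the
`(φ - 1)^j x`, on which `P(φ)` is multiplication by `P(1)`. -/
theorem IsUnipotentAut.annihilatorsVanishAtOne (h : IsUnipotentAut φ) (p : ℕ) :
    AnnihilatorsVanishAtOne p (φ : Module.End ℤ (Fin d → ℤ)) := by
  intro x hx P hP
  set ψ : Module.End ℤ (Fin d → ℤ) := (φ : Module.End ℤ (Fin d → ℤ))
  obtain ⟨j, hj, hj'⟩ : ∃ j : ℕ, ((ψ - 1) ^ j) x ≠ 0 ∧ ((ψ - 1) ^ (j + 1)) x = 0 := by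
    by_contra! hall
    have hne (j : ℕ) : ((ψ - 1) ^ j) x ≠ 0 := by
      induction j with
      | zero => simpa using hx
      | succ j ih => exact hall j ih
    exact hne d (by rw [show (ψ - 1) ^ d = 0 from h, LinearMap.zero_apply])
  set y := ((ψ - 1) ^ j) x with hy
  have hy1 : aeval ψ (X - C 1 : ℤ[X]) y = 0 := by
    rw [pow_succ', Module.End.mul_apply, ← hy] at hj'
    simpa using hj'
  have hPy : aeval ψ P y = 0 := by
    have hpow : (ψ - 1) ^ j = aeval ψ ((X - 1) ^ j : ℤ[X]) := by simp
    rw [hy, hpow, ← Module.End.mul_apply, ← map_mul, mul_comm, map_mul, Module.End.mul_apply, hP,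
      map_zero]
  have h1 : aeval ψ (C (P.eval 1)) y = 0 := by
    obtain ⟨R, hR⟩ : (X - C 1 : ℤ[X]) ∣ P - C (P.eval 1) := X_sub_C_dvd_sub_C_eval
    rw [← sub_sub_cancel P (C (P.eval 1)), hR, map_sub, LinearMap.sub_apply, hPy, mul_comm,
      map_mul, Module.End.mul_apply, hy1, map_zero, sub_zero]
  rw [aeval_C, Module.algebraMap_end_apply] at h1
  rw [(smul_eq_zero.1 h1).resolve_right hj]
  exact dvd_zero _

/-- Write the characteristic polynomial as `(X - 1)^k g` with `g(1) ≠ 0`. The image of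
`(φ - 1)^k` is killed by `g(φ)`, so it is zero. -/
theorem isUnipotentAut_of_annihilatorsVanishAtOne
    (h : ∀ p : ℕ, p.Prime → AnnihilatorsVanishAtOne p (φ : Module.End ℤ (Fin d → ℤ))) :
    IsUnipotentAut φ := by
  set ψ : Module.End ℤ (Fin d → ℤ) := (φ : Module.End ℤ (Fin d → ℤ))
  obtain ⟨g, hg, hg1⟩ := exists_eq_pow_rootMultiplicity_mul_and_not_dvd ψ.charpoly
    ψ.charpoly_monic.ne_zero 1
  rw [dvd_iff_isRoot, IsRoot.def] at hg1
  rw [isUnipotentAut_iff_isNilpotent]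
  refine ⟨ψ.charpoly.rootMultiplicity 1, LinearMap.ext fun x ↦ ?_⟩
  by_contra hx
  -- a prime larger than `|g(1)|` contradicts the criterion
  obtain ⟨p, hle, hp⟩ := Nat.exists_infinite_primes ((g.eval 1).natAbs + 1)
  have hdvd := h p hp _ hx g (by
    have h1 := LinearMap.aeval_self_charpoly ψ
    rw [hg, mul_comm, map_mul] at h1
    have h2 := LinearMap.congr_fun h1 x
    rw [Module.End.mul_apply] at h2
    simpa using h2)
  exact absurd (Nat.le_of_dvd (Int.natAbs_pos.2 hg1) (Int.natCast_dvd.1 hdvd)) (by omega)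

theorem zpow_sub_self_mem_range_pow_succ (n : ℕ) (m : ℤ) (v : Fin d → ℤ)
    (hv : v ∈ LinearMap.range (((φ : Module.End ℤ (Fin d → ℤ)) - 1) ^ n)) :
    v - (φ ^ m) v ∈ LinearMap.range (((φ : Module.End ℤ (Fin d → ℤ)) - 1) ^ (n + 1)) := by
  obtain ⟨w, rfl⟩ := hv
  set N := (φ : Module.End ℤ (Fin d → ℤ)) - 1 with hN
  have hφ (u) : φ u = u + N u := by simp [hN]
  have hcomm (k : ℕ) (u) : φ ((N ^ k) u) = (N ^ k) (φ u) := by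
    have : Commute (φ : Module.End ℤ (Fin d → ℤ)) (N ^ k) :=
      ((Commute.refl _).sub_right (Commute.one_right _)).pow_right k
    exact LinearMap.congr_fun this u
  have hsymm (k : ℕ) (u) : φ.symm ((N ^ k) u) = (N ^ k) (φ.symm u) := by
    rw [LinearEquiv.symm_apply_eq, hcomm, LinearEquiv.apply_symm_apply]
  induction m using Int.induction_on generalizing w with
  | zero => simp
  | succ m ih =>
    rw [zpow_add_one, LinearEquiv.mul_apply, hcomm]
    have h2 : (N ^ n) w - (N ^ n) (φ w) ∈ LinearMap.range (N ^ (n + 1)) :=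
      ⟨-w, by rw [pow_succ, Module.End.mul_apply, hφ]; simp⟩
    simpa using add_mem h2 (ih (φ w))
  | pred m ih =>
    rw [zpow_sub_one, LinearEquiv.mul_apply]
    change (N ^ n) w - (φ ^ (-(m : ℤ))) (φ.symm ((N ^ n) w)) ∈ _
    rw [hsymm]
    have h2 : (N ^ n) w - (N ^ n) (φ.symm w) ∈ LinearMap.range (N ^ (n + 1)) := by
      refine ⟨φ.symm w, ?_⟩
      have := hφ (φ.symm w)
      rw [LinearEquiv.apply_symm_apply] at this
      rw [pow_succ, Module.End.mul_apply, ← map_sub]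
      congr 1
      rw [eq_sub_iff_add_eq', ← this]
    simpa using add_mem h2 (ih (φ.symm w))

/-- The groups `(φ - 1)^n ℤ^d` of translations form a descending central series. -/
theorem IsUnipotentAut.isNilpotent_mappingTorus (h : IsUnipotentAut φ) :
    Group.IsNilpotent (MappingTorus φ) := by
  let N := (φ : Module.End ℤ (Fin d → ℤ)) - 1
  -- the series is `G, T 0, T 1, …`, where `T 0` is the group of all translations
  let T (n : ℕ) : Subgroup (MappingTorus φ) :=
    (AddSubgroup.toSubgroup (LinearMap.range (N ^ n)).toAddSubgroup).map SemidirectProduct.inl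
  have hT {n : ℕ} {v : Fin d → ℤ} (hv : v ∈ LinearMap.range (N ^ n)) :
      MappingTorus.trans φ v ∈ T n := ⟨Multiplicative.ofAdd v, hv, rfl⟩
  refine (Subgroup.nilpotent_iff_finite_descending_central_series _).2
    ⟨d + 1, fun n ↦ n.casesOn ⊤ T, ⟨rfl, fun x n hx g ↦ ?_⟩, ?_⟩
  · cases n with
    | zero =>
      have h1 : ⁅x, g⁆.right = 1 :=
        (map_commutatorElement SemidirectProduct.rightHom x g).trans
          (commutatorElement_eq_one_iff_commute.2 (Commute.all x.right g.right))
      have h2 : ⁅x, g⁆ = MappingTorus.trans φ ⁅x, g⁆.left.toAdd := SemidirectProduct.ext rfl h1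
      rw [h2]
      exact hT ⟨_, rfl⟩
    | succ n =>
      obtain ⟨v, hv, rfl⟩ := hx
      change ⁅MappingTorus.trans φ v.toAdd, g⁆ ∈ T (n + 1)
      rw [MappingTorus.commutator_trans]
      exact hT (zpow_sub_self_mem_range_pow_succ φ n _ _ hv)
  · refine (Subgroup.eq_bot_iff_forall _).2 ?_
    rintro _ ⟨v, ⟨w, hw⟩, rfl⟩
    have : (N ^ d) w = 0 := by rw [show N ^ d = 0 from h, LinearMap.zero_apply]
    rw [this] at hw
    rw [show v = 1 from hw.symm, map_one]

theorem isNilpotent_mappingTorus_iff :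
    Group.IsNilpotent (MappingTorus φ) ↔ IsUnipotentAut φ := by
  refine ⟨fun h ↦ ?_, fun h ↦ h.isNilpotent_mappingTorus φ⟩
  obtain ⟨c, hc⟩ := Subgroup.nilpotent_iff_lowerCentralSeries.1 h
  refine (isUnipotentAut_iff_isNilpotent φ).2 ⟨c, LinearMap.ext fun x ↦ ?_⟩
  have := MappingTorus.map_trans_sub_one_pow_mem_lowerCentralSeries φ (MonoidHom.id _) x c
  rw [hc, Subgroup.mem_bot, MonoidHom.id_apply, ← MappingTorus.trans_zero φ] at this
  exact MappingTorus.trans_injective φ this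

theorem forall_isResiduallyP_mappingTorus_iff :
    (∀ p : ℕ, p.Prime → IsResiduallyP p (MappingTorus φ)) ↔ IsUnipotentAut φ :=
  ⟨fun h ↦ isUnipotentAut_of_annihilatorsVanishAtOne φ
    fun p hp ↦ (isResiduallyP_mappingTorus_iff φ hp).1 (h p hp),
   fun h p hp ↦ (isResiduallyP_mappingTorus_iff φ hp).2 (h.annihilatorsVanishAtOne φ p)⟩

/-! ### Quasi-unipotent automorphisms -/

theorem isVirtuallyResiduallyAllPrimes_mappingTorus_iff :
    IsVirtuallyResiduallyAllPrimes (MappingTorus φ) ↔ IsQuasiUnipotentAut φ := by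
  constructor
  · rintro ⟨H, hH, hres⟩
    obtain ⟨k, hk, f, hf⟩ := MappingTorus.exists_injective_of_finiteIndex φ H
    exact ⟨k, hk, (forall_isResiduallyP_mappingTorus_iff (φ ^ k)).1
      fun p hp ↦ (hres p hp).of_injective f hf⟩
  · rintro ⟨k, hk, h⟩
    refine ⟨_, MappingTorus.finiteIndex_range_scale φ hk.ne', fun p hp ↦ ?_⟩
    let e := MonoidHom.ofInjective (MappingTorus.scale_injective φ one_ne_zero hk.ne')
    exact ((forall_isResiduallyP_mappingTorus_iff (φ ^ k)).2 h p hp).of_injective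
      e.symm.toMonoidHom e.symm.injective

theorem isVirtuallyNilpotent_mappingTorus_iff :
    Group.IsVirtuallyNilpotent (MappingTorus φ) ↔ IsQuasiUnipotentAut φ := by
  constructor
  · rintro ⟨H, hnil, hH⟩
    obtain ⟨k, hk, f, hf⟩ := MappingTorus.exists_injective_of_finiteIndex φ H
    exact ⟨k, hk, (isNilpotent_mappingTorus_iff (φ ^ k)).1 (hnil.of_injective f hf)⟩
  · rintro ⟨k, hk, h⟩
    refine ⟨_, ?_, MappingTorus.finiteIndex_range_scale φ hk.ne'⟩
    exact (Group.isNilpotent_congr (MonoidHom.ofInjective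
      (MappingTorus.scale_injective φ one_ne_zero hk.ne'))).1 (h.isNilpotent_mappingTorus (φ ^ k))

end

theorem theorem1 (d : ℕ) (φ : (Fin d → ℤ) ≃ₗ[ℤ] (Fin d → ℤ)) :
    (∀ p : ℕ, p.Prime →
      (IsResiduallyP p (MappingTorus φ) ↔
        ∀ P : ℤ[X], Irreducible P → P ∣ LinearMap.charpoly (φ : Module.End ℤ (Fin d → ℤ)) →
          P.eval 1 ≡ 0 [ZMOD (p : ℤ)])) ∧
    (((∀ p : ℕ, p.Prime → IsResiduallyP p (MappingTorus φ)) ↔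
        Group.IsNilpotent (MappingTorus φ)) ∧
      (Group.IsNilpotent (MappingTorus φ) ↔ IsUnipotentAut φ)) ∧
    ((IsVirtuallyResiduallyAllPrimes (MappingTorus φ) ↔
        Group.IsVirtuallyNilpotent (MappingTorus φ)) ∧
      (Group.IsVirtuallyNilpotent (MappingTorus φ) ↔ IsQuasiUnipotentAut φ)) := by
  refine ⟨fun p hp ↦ ?_, ⟨?_, isNilpotent_mappingTorus_iff φ⟩, ?_,
    isVirtuallyNilpotent_mappingTorus_iff φ⟩
  · exact (isResiduallyP_mappingTorus_iff φ hp).trans (annihilatorsVanishAtOne_iff p _)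
  · exact (forall_isResiduallyP_mappingTorus_iff φ).trans (isNilpotent_mappingTorus_iff φ).symm
  · exact (isVirtuallyResiduallyAllPrimes_mappingTorus_iff φ).trans
      (isVirtuallyNilpotent_mappingTorus_iff φ).symm
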